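/- Conventions. Let $G$ be a group and $A$ a set. The group $G$ acts on $A^G$ by $(gx)(h)=x(g^{-1}h)$, and $A^G$ carries the prodiscrete topology, i.e. the product of the discrete topologies on the factors $A$. A configuration $x\in A^G$ is *periodic* if its $G$-orbit is finite. For $E\subset G$ and $\Sigma\subset A^G$ put $\Sigma_E=\{x|_E : x\in\Sigma\}\subset A^E$. A group $G$ is *polycyclic-by-finite* if there are subgroups $\{1\}=G_0\subset G_1\subset\cdots\subset G_n=G$ such that, for every $1\le k\le n$, $G_{k-1}$ is normal in $G_k$ and $G_k/G_{k-1}$ is cyclic or finite. An *admissible Artinian structure* on a group $A$ is a family $(\mathcal H_n)_{n\ge 1}$, where $\mathcal H_n$ is a collection of subgroups of $A^n$ (called *admissible subgroups* of $A^n$), such that: (1) $\{1_A\}\in\mathcal H_1$; (2) for all $m\ge n\ge 1$ and every projection $\pi\colon A^m\to A^n$ induced by an injection $\{1,\dots,n\}\to\{1,\dots,m\}$, one has $\pi(H)\in\mathcal H_n$ for all $H\in\mathcal H_m$ and $\pi^{-1}(K)\in\mathcal H_m$ for all $K\in\mathcal H_n$; (3) $H\cap K\in\mathcal H_n$ for all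 $n\ge 1$ and $H,K\in\mathcal H_n$; (4) for every $n\ge1$, every descending sequence of elements of $\mathcal H_n$ is eventually constant. A group equipped with such a structure is an *admissible Artinian group structure*. For a nonempty finite set $E$, the admissible subgroups of $A^E$ are those corresponding to the admissible subgroups of $A^{|E|}$ under a bijection $\{1,\dots,|E|\}\to E$ (by (2) the choice of the bijection is irrelevant). An *admissible group subshift* of $A^G$ is a $G$-invariant subset $\Sigma\subset A^G$ which is closed in the prodiscrete topology and such that $\Sigma_E$ is an admissible subgroup of $A^E$ for every nonempty finite subset $E\subset G$. It is *strongly irreducible* if there is a finite subset $\Delta\subset G$ such that for all finite subsets $E,F\subset G$ with $E\cap F\Delta=\varnothing$ and all $y,z\in\Sigma$ there is $x\in\Sigma$ with $x|_E=y|_E$ and $x|_F=z|_F$. **Statement.** Let $G$ be a polycyclic-by-finite group, let $A$ be an admissible Artinian group structure, and let $\Sigma\subset A^G$ be a strongly irreducible admissible group subshift. Then the periodic configurations belonging to $\Sigma$ are dense in $\Sigma$ for the prodiscrete topology. -/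

import Mathlib

open scoped Pointwise

/-- A group `G` is polycyclic-by-finite if there are subgroups
`{1} = H 0 ≤ H 1 ≤ ⋯ ≤ H n = G`, each normal in the next, all of whose successive quotients are
cyclic or finite. -/
def IsPolycyclicByFinite (G : Type*) [Group G] : Prop :=
  ∃ (n : ℕ) (H : ℕ → Subgroup G), H 0 = ⊥ ∧ H n = ⊤ ∧
    ∀ k < n, H k ≤ H (k + 1) ∧
      ∃ _ : ((H k).subgroupOf (H (k + 1))).Normal,
        IsCyclic (H (k + 1) ⧸ (H k).subgroupOf (H (k + 1))) ∨
          Finite (H (k + 1) ⧸ (H k).subgroupOf (H (k + 1)))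

/-- The homomorphism `Γ^ι → Γ^κ`, `x ↦ x ∘ f`, induced by a map `f : κ → ι` of index sets. -/
def coordProj (Γ : Type*) [Group Γ] {ι κ : Type*} (f : κ → ι) : (ι → Γ) →* (κ → Γ) where
  toFun x := x ∘ f
  map_one' := rfl
  map_mul' _ _ := rfl

/-- An admissible Artinian structure on a group `Γ`: for every `n ≥ 1` a collection `carrier n` of
subgroups of `Γ^n` (the admissible subgroups) with the four properties below. The value `carrier 0`
carries no information and is never used. -/
structure AdmissibleArtinianStructure (Γ : Type*) [Group Γ] where
  carrier : (n : ℕ) → Set (Subgroup (Fin n → Γ))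
  bot_mem : ⊥ ∈ carrier 1
  map_mem : ∀ {m n : ℕ}, 1 ≤ n → ∀ f : Fin n → Fin m, Function.Injective f →
    ∀ H ∈ carrier m, H.map (coordProj Γ f) ∈ carrier n
  comap_mem : ∀ {m n : ℕ}, 1 ≤ n → ∀ f : Fin n → Fin m, Function.Injective f →
    ∀ H ∈ carrier n, H.comap (coordProj Γ f) ∈ carrier m
  inf_mem : ∀ {n : ℕ}, 1 ≤ n → ∀ H ∈ carrier n, ∀ K ∈ carrier n, H ⊓ K ∈ carrier n
  dcc : ∀ {n : ℕ}, 1 ≤ n → ∀ H : ℕ → Subgroup (Fin n → Γ), (∀ k, H k ∈ carrier n) →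
    Antitone H → ∃ N, ∀ k ≥ N, H k = H N

/-- A subset of `Γ^ι`, for a nonempty finite index set `ι`, is an admissible subgroup if some
(equivalently any) bijection `{1, …, |ι|} → ι` identifies it with an admissible subgroup of
`Γ^|ι|`. -/
def AdmissibleArtinianStructure.IsAdmissible {Γ : Type*} [Group Γ]
    (𝓗 : AdmissibleArtinianStructure Γ) {ι : Type*} [Fintype ι] (S : Set (ι → Γ)) : Prop :=
  ∃ (e : Fin (Fintype.card ι) ≃ ι) (H : Subgroup (Fin (Fintype.card ι) → Γ)),
    H ∈ 𝓗.carrier (Fintype.card ι) ∧ S = (H.comap (coordProj Γ e) : Set (ι → Γ))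

/-- Admissibility of a subset of `Γ^ι` does not depend on the chosen bijection. -/
theorem AdmissibleArtinianStructure.isAdmissible_iff_forall {Γ : Type*} [Group Γ]
    (𝓗 : AdmissibleArtinianStructure Γ) {ι : Type*} [Fintype ι] [Nonempty ι]
    (S : Set (ι → Γ)) :
    𝓗.IsAdmissible S ↔ ∀ e : Fin (Fintype.card ι) ≃ ι,
      ∃ H : Subgroup (Fin (Fintype.card ι) → Γ),
        H ∈ 𝓗.carrier (Fintype.card ι) ∧ S = (H.comap (coordProj Γ e) : Set (ι → Γ)) := by
  refine ⟨?_, fun h => ⟨(Fintype.equivFin ι).symm, h _⟩⟩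
  rintro ⟨e, H, hH, rfl⟩ e'
  refine ⟨H.comap (coordProj Γ (e.trans e'.symm)), 𝓗.comap_mem Fintype.card_pos _
    (e.trans e'.symm).injective H hH, ?_⟩
  ext x
  have : (x ∘ e') ∘ (e.trans e'.symm) = x ∘ e := by
    funext i
    simp
  change x ∘ e ∈ H ↔ (x ∘ e') ∘ (e.trans e'.symm) ∈ H
  rw [this]

/-- A subshift of `A^G` (closed and shift-invariant, for the product of the discrete topologies) is
an admissible group subshift if its restriction to every nonempty finite subset `E` of `G` is an
admissible subgroup of `A^E`. -/
def IsAdmissibleGroupSubshift {A G : Type*} [Group A] [TopologicalSpace A] [DiscreteTopology A]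
    [Group G] (𝓗 : AdmissibleArtinianStructure A)
    (X : SymbolicDynamics.FullShift.MulSubshift A G) : Prop :=
  ∀ E : Finset G, E.Nonempty →
    𝓗.IsAdmissible ((fun x : G → A => fun i : E => x i) '' X.carrier)

/-- A set `X` of configurations is strongly irreducible if there is a finite set `Δ ⊆ G` such that
any two elements of `X` can be glued along finite sets `E`, `F` with `E ∩ FΔ = ∅`. -/
def IsStronglyIrreducible {A G : Type*} [Group G] (X : Set (G → A)) : Prop :=
  ∃ Δ : Finset G, ∀ E F : Finset G,
    Disjoint (E : Set G) ((F : Set G) * (Δ : Set G)) →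
      ∀ y ∈ X, ∀ z ∈ X, ∃ x ∈ X, (∀ g ∈ E, x g = y g) ∧ (∀ g ∈ F, x g = z g)

/-- A configuration is periodic if its orbit under the shift action of `G`,
`(gx)(h) = x (g⁻¹ h)`, is finite. -/
def IsPeriodicConfig {A G : Type*} [Group G] (x : G → A) : Prop :=
  (Set.range fun g : G => fun h : G => x (g⁻¹ * h)).Finite

/-! ### Cylinders, systems of projections and eventual images -/

section Cylinders

variable {G A : Type*} [Group A]

/-! The subshift is shown to be of finite type, and periodic points are then built by periodising a
finite pattern.

Finite type follows from a descending chain condition on shift-invariant closed admissible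
subgroups, applied to the subshifts cut out by larger and larger windows. The chain condition is
proved like Hilbert's basis theorem, by induction along the polycyclic series (`HasDCC.of_cyclic`):
the role of leading coefficients is played by the values on `H F` of configurations trivial on the
preceding translates. A closed subgroup is handled only through its finite projections; the Artinian
condition replaces compactness by making decreasing projections stabilise (`exists_limProj_eq`).

For density, strong irreducibility joins a pattern of `x` on `Ω` to the trivial configuration around
it. Residual finiteness of `G` (`exists_finiteIndex_notMem`) gives a finite-index subgroup whose
translates of this pattern are disjoint. Their union, extended by `1`, is periodic, and each of its
windows is a window of a shift of the pattern or is trivial, so it lies in the subshift by finite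
type. -/

/-- The configurations that agree on `E` with some element of `C`. -/
def locProj (E : Finset G) (C : Subgroup (G → A)) : Subgroup (G → A) where
  carrier := {x | ∃ y ∈ C, ∀ g ∈ E, y g = x g}
  one_mem' := ⟨1, C.one_mem, fun _ _ => rfl⟩
  mul_mem' := by
    rintro a b ⟨y, hy, hya⟩ ⟨z, hz, hzb⟩
    exact ⟨y * z, C.mul_mem hy hz, fun g hg => by simp [hya g hg, hzb g hg]⟩
  inv_mem' := by
    rintro a ⟨y, hy, hya⟩
    exact ⟨y⁻¹, C.inv_mem hy, fun g hg => by simp [hya g hg]⟩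

/-- The configurations that are trivial on `S`. -/
def trivialOn (A : Type*) [Group A] (S : Set G) : Subgroup (G → A) where
  carrier := {x | ∀ g ∈ S, x g = 1}
  one_mem' := fun _ _ => rfl
  mul_mem' := fun ha hb g hg => by simp [ha g hg, hb g hg]
  inv_mem' := fun ha g hg => by simp [ha g hg]

theorem mem_locProj {E : Finset G} {C : Subgroup (G → A)} {x : G → A} :
    x ∈ locProj E C ↔ ∃ y ∈ C, ∀ g ∈ E, y g = x g := Iff.rfl

theorem mem_trivialOn {S : Set G} {x : G → A} : x ∈ trivialOn A S ↔ ∀ g ∈ S, x g = 1 := Iff.rfl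

theorem le_locProj (E : Finset G) (C : Subgroup (G → A)) : C ≤ locProj E C :=
  fun x hx => ⟨x, hx, fun _ _ => rfl⟩

theorem locProj_mono (E : Finset G) {C D : Subgroup (G → A)} (h : C ≤ D) :
    locProj E C ≤ locProj E D :=
  fun _ ⟨y, hy, hyx⟩ => ⟨y, h hy, hyx⟩

theorem locProj_locProj {E E' : Finset G} (h : E' ⊆ E) (C : Subgroup (G → A)) :
    locProj E' (locProj E C) = locProj E' C := by
  ext x
  constructor
  · rintro ⟨y, ⟨z, hz, hzy⟩, hyx⟩
    exact ⟨z, hz, fun g hg => (hzy g (h hg)).trans (hyx g hg)⟩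
  · exact fun hx => locProj_mono _ (le_locProj _ _) hx

theorem locProj_empty (C : Subgroup (G → A)) : locProj ∅ C = ⊤ :=
  top_unique fun _ _ => ⟨1, C.one_mem, by simp⟩

/-- The preimages in `A^G` of admissible subgroups of finite powers of `A`. -/
def AdmissibleArtinianStructure.IsCylinder (𝓗 : AdmissibleArtinianStructure A)
    (C : Subgroup (G → A)) : Prop :=
  ∃ n, 1 ≤ n ∧ ∃ f : Fin n → G, Function.Injective f ∧
    ∃ H ∈ 𝓗.carrier n, C = H.comap (coordProj A f)

theorem Finset.Nonempty.exists_enumeration {E : Finset G} (hE : E.Nonempty) :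
    ∃ n, 1 ≤ n ∧ ∃ f : Fin n → G, Function.Injective f ∧ ∀ g, g ∈ E ↔ ∃ i, f i = g := by
  refine ⟨E.card, hE.card_pos, fun i => E.equivFin.symm i,
    Subtype.val_injective.comp E.equivFin.symm.injective, fun g => ⟨fun hg => ?_, ?_⟩⟩
  · exact ⟨E.equivFin ⟨g, hg⟩, by simp⟩
  · rintro ⟨i, rfl⟩
    exact (E.equivFin.symm i).2

theorem exists_comp_eq {m n : ℕ} {f : Fin n → G} {f' : Fin m → G} (hf : Function.Injective f)
    (h : ∀ i, ∃ j, f' j = f i) : ∃ σ : Fin n → Fin m, Function.Injective σ ∧ f' ∘ σ = f := by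
  choose σ hσ using h
  refine ⟨σ, fun i j hij => hf ?_, funext hσ⟩
  rw [← hσ i, ← hσ j, hij]

theorem coordProj_surjective {ι κ : Type*} {f : κ → ι} (hf : Function.Injective f) :
    Function.Surjective (coordProj A f) := fun y =>
  ⟨Function.extend f y 1, by
    funext i
    exact hf.extend_apply _ _ _⟩

namespace AdmissibleArtinianStructure

variable {𝓗 : AdmissibleArtinianStructure A} {C D : Subgroup (G → A)}

/-- Lets several cylinders be described over one common enumeration of coordinates. -/
theorem IsCylinder.exists_support (hC : 𝓗.IsCylinder C) :
    ∃ E : Finset G, E.Nonempty ∧ ∀ (m : ℕ) (f : Fin m → G), Function.Injective f →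
      (∀ g ∈ E, ∃ i, f i = g) → ∃ H ∈ 𝓗.carrier m, C = H.comap (coordProj A f) := by
  classical
  obtain ⟨n, hn, f, hf, H, hH, rfl⟩ := hC
  refine ⟨Finset.univ.image f, ⟨f ⟨0, hn⟩, by simp⟩, fun m f' _ hE => ?_⟩
  obtain ⟨σ, hσ, rfl⟩ := exists_comp_eq (f' := f') hf fun i => hE _ (by simp)
  exact ⟨H.comap (coordProj A σ), 𝓗.comap_mem hn σ hσ H hH, rfl⟩

/-- Pull back to the union of `E` and a support of `C`, then project to `E`: both operations
preserve admissibility. -/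
theorem IsCylinder.locProj_eq_comap (hC : 𝓗.IsCylinder C) {E : Finset G} {n : ℕ} (hn : 1 ≤ n)
    {f : Fin n → G} (hf : Function.Injective f) (hE : ∀ g, g ∈ E ↔ ∃ i, f i = g) :
    ∃ H ∈ 𝓗.carrier n, locProj E C = H.comap (coordProj A f) := by
  classical
  obtain ⟨E₀, hE₀, h⟩ := hC.exists_support
  obtain ⟨m, -, f', hf', hm⟩ := (hE₀.mono (Finset.subset_union_left (s₂ := E))).exists_enumeration
  obtain ⟨H, hH, rfl⟩ := h m f' hf' fun g hg => (hm g).1 (Finset.mem_union_left _ hg)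
  obtain ⟨σ, hσ, rfl⟩ := exists_comp_eq (f' := f') hf fun i =>
    (hm _).1 (Finset.mem_union_right _ ((hE _).2 ⟨i, rfl⟩))
  refine ⟨H.map (coordProj A σ), 𝓗.map_mem hn σ hσ H hH, ?_⟩
  ext x
  constructor
  · rintro ⟨y, hy, hyx⟩
    exact ⟨y ∘ f', hy, funext fun i => hyx _ ((hE _).2 ⟨i, rfl⟩)⟩
  · rintro ⟨a, ha, hax⟩
    obtain ⟨y, rfl⟩ := coordProj_surjective hf' a
    refine ⟨y, ha, fun g hg => ?_⟩
    obtain ⟨i, rfl⟩ := (hE g).1 hg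
    exact congrFun hax i

theorem isCylinder_eval_eq_one (𝓗 : AdmissibleArtinianStructure A) (g : G) :
    𝓗.IsCylinder (trivialOn A {g}) := by
  refine ⟨1, le_rfl, fun _ => g, fun i j _ => Subsingleton.elim i j, ⊥, 𝓗.bot_mem, ?_⟩
  ext x
  simp only [mem_trivialOn, Set.mem_singleton_iff, forall_eq, Subgroup.mem_comap,
    Subgroup.mem_bot]
  exact ⟨fun h => funext fun _ => h, fun h => congrFun h 0⟩

/-- The axioms do not list `A` itself as admissible. It is the second projection of `{1} × A`, the
preimage of the trivial subgroup in `A²`. -/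
theorem isCylinder_top [Nonempty G] (𝓗 : AdmissibleArtinianStructure A) :
    𝓗.IsCylinder (⊤ : Subgroup (G → A)) := by
  obtain ⟨g⟩ := ‹Nonempty G›
  have h0 : Function.Injective (fun _ : Fin 1 => (0 : Fin 2)) := fun i j _ => Subsingleton.elim i j
  have h1 : Function.Injective (fun _ : Fin 1 => (1 : Fin 2)) := fun i j _ => Subsingleton.elim i j
  refine ⟨1, le_rfl, fun _ => g, fun i j _ => Subsingleton.elim i j, _,
    𝓗.map_mem le_rfl _ h1 _ (𝓗.comap_mem le_rfl _ h0 _ 𝓗.bot_mem), ?_⟩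
  refine (top_unique fun x _ => ?_).symm
  refine ⟨![1, x g], ?_, ?_⟩
  · change _ = _
    ext i
    simp [coordProj]
  · ext i
    simp [coordProj]

theorem IsCylinder.locProj [Nonempty G] (hC : 𝓗.IsCylinder C) (E : Finset G) :
    𝓗.IsCylinder (locProj E C) := by
  obtain rfl | hE := E.eq_empty_or_nonempty
  · rw [locProj_empty]
    exact 𝓗.isCylinder_top
  · obtain ⟨n, hn, f, hf, h⟩ := hE.exists_enumeration
    exact ⟨n, hn, f, hf, hC.locProj_eq_comap hn hf h⟩

theorem IsCylinder.inf (hC : 𝓗.IsCylinder C) (hD : 𝓗.IsCylinder D) : 𝓗.IsCylinder (C ⊓ D) := by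
  classical
  obtain ⟨E, hE, h⟩ := hC.exists_support
  obtain ⟨E', -, h'⟩ := hD.exists_support
  obtain ⟨m, hm, f, hf, hfm⟩ :=
    (hE.mono (Finset.subset_union_left (s₂ := E'))).exists_enumeration
  obtain ⟨H, hH, rfl⟩ := h m f hf fun g hg => (hfm g).1 (Finset.mem_union_left _ hg)
  obtain ⟨K, hK, rfl⟩ := h' m f hf fun g hg => (hfm g).1 (Finset.mem_union_right _ hg)
  exact ⟨m, hm, f, hf, H ⊓ K, 𝓗.inf_mem hm H hH K hK, (Subgroup.comap_inf _ _ _).symm⟩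

theorem isCylinder_finset_inf [Nonempty G] {ι : Type*} (T : Finset ι) {C : ι → Subgroup (G → A)}
    (hC : ∀ i, 𝓗.IsCylinder (C i)) : 𝓗.IsCylinder (T.inf C) := by
  classical
  induction T using Finset.induction_on with
  | empty => exact 𝓗.isCylinder_top
  | insert i T _ ih =>
    rw [Finset.inf_insert]
    exact (hC i).inf ih

theorem isCylinder_trivialOn [Nonempty G] (𝓗 : AdmissibleArtinianStructure A) {S : Set G}
    (hS : S.Finite) : 𝓗.IsCylinder (trivialOn A S) := by
  induction S, hS using Set.Finite.induction_on with
  | empty =>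
    convert 𝓗.isCylinder_top (G := G)
    exact top_unique fun _ _ => by simp [mem_trivialOn]
  | @insert g S _ _ ih =>
    convert (𝓗.isCylinder_eval_eq_one g).inf ih
    ext x
    simp [mem_trivialOn]

theorem IsCylinder.dcc {E : Finset G} {C : ℕ → Subgroup (G → A)} (hC : ∀ n, 𝓗.IsCylinder (C n))
    (hE : ∀ n, _root_.locProj E (C n) = C n) (hanti : Antitone C) : ∃ N, ∀ n ≥ N, C n = C N := by
  obtain rfl | hne := E.eq_empty_or_nonempty
  · simp_rw [locProj_empty] at hE
    exact ⟨0, fun n _ => (hE n).symm.trans (hE 0)⟩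
  · obtain ⟨m, hm, f, hf, h⟩ := hne.exists_enumeration
    choose H hH hCH using fun n => (hC n).locProj_eq_comap hm hf h
    simp_rw [hE] at hCH
    obtain ⟨N, hN⟩ := 𝓗.dcc hm H hH fun i j hij => by
      have := hanti hij
      rwa [hCH, hCH, Subgroup.comap_le_comap_of_surjective (coordProj_surjective hf)] at this
    exact ⟨N, fun n hn => by rw [hCH, hCH, hN n hn]⟩

theorem IsCylinder.exists_minimal {ι : Type*} [Nonempty ι] {E : Finset G}
    {C : ι → Subgroup (G → A)} (hC : ∀ i, 𝓗.IsCylinder (C i))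
    (hE : ∀ i, _root_.locProj E (C i) = C i) : ∃ i, ∀ j, C j ≤ C i → C j = C i := by
  by_contra! h
  choose s hs hs' using h
  obtain ⟨i⟩ := ‹Nonempty ι›
  obtain ⟨N, hN⟩ := IsCylinder.dcc (C := fun n => C (s^[n] i)) (fun _ => hC _) (fun _ => hE _)
    (antitone_nat_of_succ_le fun n => by
      rw [Function.iterate_succ_apply']
      exact hs _)
  have := hN (N + 1) (Nat.le_succ N)
  rw [Function.iterate_succ_apply'] at this
  exact hs' _ this

/-- A family of cylinders indexed by finite subsets `E` of `G`, the `E`-th one being the projection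
to `E` of every later one. It stands for a closed admissible subgroup of `A^G`. -/
structure IsSystem (𝓗 : AdmissibleArtinianStructure A) (Λ : Finset G → Subgroup (G → A)) :
    Prop where
  isCylinder : ∀ E, 𝓗.IsCylinder (Λ E)
  locProj_eq : ∀ {E' E : Finset G}, E' ⊆ E → _root_.locProj E' (Λ E) = Λ E'

theorem IsSystem.antitone {Λ : Finset G → Subgroup (G → A)} (hΛ : 𝓗.IsSystem Λ) : Antitone Λ :=
  fun E' E h => by
    rw [← hΛ.locProj_eq h]
    exact le_locProj _ _

end AdmissibleArtinianStructure

/-- The eventual projections to finite sets of a descending family of cylinders. -/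
def limProj (C : Finset G → Subgroup (G → A)) (E : Finset G) : Subgroup (G → A) :=
  ⨅ T, locProj E (C T)

theorem limProj_le (C : Finset G → Subgroup (G → A)) (E T : Finset G) :
    limProj C E ≤ locProj E (C T) := iInf_le _ T

theorem limProj_mono {C D : Finset G → Subgroup (G → A)} (h : ∀ T, C T ≤ D T) (E : Finset G) :
    limProj C E ≤ limProj D E := iInf_mono fun T => locProj_mono E (h T)

namespace AdmissibleArtinianStructure

variable {𝓗 : AdmissibleArtinianStructure A} [Nonempty G] {C : Finset G → Subgroup (G → A)}

/-- A Mittag-Leffler argument: the projections to the fixed set `E` form a directed family of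
cylinders supported on `E`, so a minimal one is the least. -/
theorem exists_limProj_eq (hC : ∀ T, 𝓗.IsCylinder (C T)) (hanti : Antitone C) (E : Finset G) :
    ∃ T, ∀ T' ⊇ T, limProj C E = locProj E (C T') := by
  classical
  obtain ⟨T, hT⟩ := IsCylinder.exists_minimal (E := E) (C := fun T => locProj E (C T))
    (fun T => (hC T).locProj E) fun T => locProj_locProj subset_rfl _
  have key : ∀ T' ⊇ T, locProj E (C T') = locProj E (C T) :=
    fun T' h => hT T' (locProj_mono E (hanti h))
  refine ⟨T, fun T' h => le_antisymm (limProj_le C E T') (le_iInf fun S => ?_)⟩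
  rw [key T' h, ← key (T ∪ S) Finset.subset_union_left]
  exact locProj_mono E (hanti Finset.subset_union_right)

theorem isSystem_limProj (hC : ∀ T, 𝓗.IsCylinder (C T)) (hanti : Antitone C) :
    𝓗.IsSystem (limProj C) := by
  classical
  constructor
  · intro E
    obtain ⟨T, hT⟩ := exists_limProj_eq hC hanti E
    rw [hT T subset_rfl]
    exact (hC T).locProj E
  · intro E' E h
    obtain ⟨T, hT⟩ := exists_limProj_eq hC hanti E
    obtain ⟨T', hT'⟩ := exists_limProj_eq hC hanti E'
    rw [hT (T ∪ T') Finset.subset_union_left, hT' (T ∪ T') Finset.subset_union_right,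
      locProj_locProj h]

end AdmissibleArtinianStructure

end Cylinders

/-! ### Shifts and equivariant families -/

section Shift

variable {G A : Type*} [Group A] [Group G]

/-- The shift `x ↦ (h ↦ x (g * h))`. -/
abbrev shiftHom (A : Type*) [Group A] (g : G) : (G → A) →* (G → A) :=
  coordProj A (fun h => g * h)

theorem shiftHom_apply (g : G) (x : G → A) (h : G) : shiftHom A g x h = x (g * h) := rfl

/-- The left translate `g E`. -/
abbrev leftTranslate (g : G) (E : Finset G) : Finset G := (Equiv.mulLeft g).finsetCongr E

theorem mem_leftTranslate {g h : G} {E : Finset G} : h ∈ leftTranslate g E ↔ g⁻¹ * h ∈ E := by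
  simp [leftTranslate, Equiv.finsetCongr_apply, Finset.mem_map_equiv]

theorem mul_mem_leftTranslate {g h : G} {E : Finset G} : g * h ∈ leftTranslate g E ↔ h ∈ E := by
  simp

theorem locProj_comap_shiftHom (g : G) (E : Finset G) (C : Subgroup (G → A)) :
    locProj (leftTranslate g E) (C.comap (shiftHom A g)) = (locProj E C).comap (shiftHom A g) := by
  ext x
  constructor
  · rintro ⟨y, hy, hyx⟩
    exact ⟨_, hy, fun h hh => hyx _ (mul_mem_leftTranslate.2 hh)⟩
  · rintro ⟨y, hy, hyx⟩
    refine ⟨fun h => y (g⁻¹ * h), ?_, fun h hh => ?_⟩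
    · change shiftHom A g (fun h => y (g⁻¹ * h)) ∈ C
      convert hy using 1
      funext h
      simp [shiftHom_apply]
    · have := hyx _ (mem_leftTranslate.1 hh)
      rwa [shiftHom_apply, mul_inv_cancel_left] at this

theorem AdmissibleArtinianStructure.IsCylinder.comap_shiftHom {𝓗 : AdmissibleArtinianStructure A}
    {C : Subgroup (G → A)} (hC : 𝓗.IsCylinder C) (g : G) :
    𝓗.IsCylinder (C.comap (shiftHom A g)) := by
  obtain ⟨n, hn, f, hf, H, hH, rfl⟩ := hC
  exact ⟨n, hn, fun i => g * f i, (mul_right_injective g).comp hf, H, hH, rfl⟩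

/-- Equivariance under left translation by elements of `H`. -/
def IsShiftInvariant (H : Subgroup G) (Λ : Finset G → Subgroup (G → A)) : Prop :=
  ∀ g ∈ H, ∀ E, Λ (leftTranslate g E) = (Λ E).comap (shiftHom A g)

theorem IsShiftInvariant.limProj {H : Subgroup G} {C : Finset G → Subgroup (G → A)}
    (hC : IsShiftInvariant H C) : IsShiftInvariant H (limProj C) := by
  intro g hg E
  rw [_root_.limProj, ← (Equiv.mulLeft g).finsetCongr.iInf_comp, _root_.limProj,
    Subgroup.comap_iInf]
  exact iInf_congr fun T => by rw [← locProj_comap_shiftHom, ← hC g hg T]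

end Shift

/-! ### The descending chain condition along group extensions -/

section DescendingChain

variable {G A : Type*} [Group A]

/-- The constraints imposed by triviality on `S`: the part of `Λ` lying over configurations that
are trivial on the part of `S` seen so far. -/
def relativePart (S : Set G) (Λ : Finset G → Subgroup (G → A)) (T : Finset G) :
    Subgroup (G → A) :=
  Λ T ⊓ trivialOn A (↑T ∩ S)

theorem relativePart_mono {S S' : Set G} {Λ Λ' : Finset G → Subgroup (G → A)} (hS : S' ⊆ S)
    (hΛ : Λ ≤ Λ') (T : Finset G) : relativePart S Λ T ≤ relativePart S' Λ' T :=
  fun _ hx => ⟨hΛ T hx.1, fun g hg => hx.2 g ⟨hg.1, hS hg.2⟩⟩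

namespace AdmissibleArtinianStructure

variable {𝓗 : AdmissibleArtinianStructure A}

theorem IsSystem.isCylinder_relativePart [Nonempty G] {Λ : Finset G → Subgroup (G → A)}
    (hΛ : 𝓗.IsSystem Λ)
    (S : Set G) (T : Finset G) : 𝓗.IsCylinder (relativePart S Λ T) :=
  (hΛ.isCylinder T).inf (𝓗.isCylinder_trivialOn (T.finite_toSet.inter_of_left S))

theorem IsSystem.antitone_relativePart {Λ : Finset G → Subgroup (G → A)} (hΛ : 𝓗.IsSystem Λ)
    (S : Set G) : Antitone (relativePart S Λ) :=
  fun _ _ h _ hx => ⟨hΛ.antitone h hx.1, fun g hg => hx.2 g ⟨h hg.1, hg.2⟩⟩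

/-- If two systems `Λ' ≤ Λ` agree inside `S`, and so do their relative parts over `S` inside `S'`,
then they agree inside `S ∪ S'`. -/
theorem IsSystem.eq_of_relativePart [Nonempty G] {Λ Λ' : Finset G → Subgroup (G → A)}
    (hΛ : 𝓗.IsSystem Λ)
    (hΛ' : 𝓗.IsSystem Λ') (hle : Λ' ≤ Λ) {S S' : Set G}
    (hS : ∀ E : Finset G, ↑E ⊆ S → Λ' E = Λ E)
    (hS' : ∀ E : Finset G, ↑E ⊆ S' →
      limProj (relativePart S Λ') E = limProj (relativePart S Λ) E)
    {E : Finset G} (hE : ↑E ⊆ S ∪ S') : Λ' E = Λ E := by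
  classical
  refine le_antisymm (hle E) fun a ha => ?_
  set E₁ := E.filter (· ∈ S')
  obtain ⟨T₀, hT₀⟩ := exists_limProj_eq (hΛ.isCylinder_relativePart S)
    (hΛ.antitone_relativePart S) E₁
  -- At this `T` the projection to `E₁` of the relative part of `Λ` already equals its limit.
  set T := T₀ ∪ E
  have hET : E ⊆ T := Finset.subset_union_right
  obtain ⟨b, hb, hba⟩ : a ∈ locProj E (Λ T) := by rwa [hΛ.locProj_eq hET]
  set T' := T.filter (· ∈ S)
  have hT' : T' ⊆ T := Finset.filter_subset _ _
  -- Choose `c` in `Λ' T` matching `b` on `T ∩ S`. The error `b * c⁻¹` is then trivial there and can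
  -- be corrected on `E₁` by some `d` in the relative part of `Λ'`, so `d * c` is the required
  -- element.
  obtain ⟨c, hc, hcb⟩ : b ∈ locProj T' (Λ' T) := by
    rw [hΛ'.locProj_eq hT', hS T' fun g hg => (Finset.mem_filter.1 hg).2]
    exact hΛ.antitone hT' hb
  have hrel : b * c⁻¹ ∈ relativePart S Λ T :=
    ⟨Subgroup.mul_mem _ hb (Subgroup.inv_mem _ (hle T hc)), fun g hg => by
      simp [hcb g (Finset.mem_filter.2 ⟨hg.1, hg.2⟩)]⟩
  have hmem : b * c⁻¹ ∈ limProj (relativePart S Λ') E₁ := by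
    rw [hS' E₁ fun g hg => (Finset.mem_filter.1 hg).2, hT₀ T Finset.subset_union_left]
    exact le_locProj _ _ hrel
  obtain ⟨d, hd, hdb⟩ := limProj_le _ E₁ T hmem
  rw [← hΛ'.locProj_eq hET]
  refine ⟨d * c, Subgroup.mul_mem _ hd.1 hc, fun g hg => ?_⟩
  rw [← hba g hg]
  by_cases hgS : g ∈ S
  · have h1 := hd.2 g ⟨hET hg, hgS⟩
    have h2 := hcb g (Finset.mem_filter.2 ⟨hET hg, hgS⟩)
    simp [h1, h2]
  · have h1 := hdb g (Finset.mem_filter.2 ⟨hg, (hE hg).resolve_left hgS⟩)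
    simp [h1]

end AdmissibleArtinianStructure

variable [Group G]

/-- Descending sequences of `H`-invariant systems stabilise on every set `H F` with `F` finite. -/
def AdmissibleArtinianStructure.HasDCC (𝓗 : AdmissibleArtinianStructure A) (H : Subgroup G) :
    Prop :=
  ∀ (F : Finset G) (Λ : ℕ → Finset G → Subgroup (G → A)), (∀ n, 𝓗.IsSystem (Λ n)) →
    (∀ n, IsShiftInvariant H (Λ n)) → Antitone Λ →
      ∃ N, ∀ n ≥ N, ∀ E : Finset G, (∀ e ∈ E, ∃ h ∈ H, ∃ f ∈ F, e = h * f) → Λ n E = Λ N E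

theorem IsShiftInvariant.relativePart {H : Subgroup G} {Λ : Finset G → Subgroup (G → A)}
    (hΛ : IsShiftInvariant H Λ) {S : Set G} (hS : ∀ h ∈ H, ∀ s, h * s ∈ S ↔ s ∈ S) :
    IsShiftInvariant H (relativePart S Λ) := by
  intro g hg T
  ext x
  rw [_root_.relativePart, hΛ g hg T]
  refine and_congr Iff.rfl ⟨fun h s hs => h (g * s) ⟨?_, (hS g hg s).2 hs.2⟩, fun h s hs => ?_⟩
  · exact mul_mem_leftTranslate.2 hs.1
  · have := h (g⁻¹ * s) ⟨mem_leftTranslate.1 hs.1, (hS _ (inv_mem hg) _).2 hs.2⟩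
    rwa [shiftHom_apply, mul_inv_cancel_left] at this

/-- The union of the translates `t⁻ⁱ H F` for `1 ≤ i ≤ n`. -/
def slab (H : Subgroup G) (t : G) (F : Finset G) (n : ℕ) : Set G :=
  {x | ∃ i : ℤ, 1 ≤ i ∧ i ≤ n ∧ ∃ h ∈ H, ∃ f ∈ F, x = t ^ (-i) * (h * f)}

theorem slab_mono (H : Subgroup G) (t : G) (F : Finset G) : Monotone (slab H t F) := by
  rintro m n hmn x ⟨i, h1, h2, hx⟩
  exact ⟨i, h1, h2.trans (by exact_mod_cast hmn), hx⟩

theorem mul_mem_slab {H : Subgroup G} {t : G} (ht : ∀ i : ℤ, ∀ h ∈ H, t ^ i * h * (t ^ i)⁻¹ ∈ H)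
    (F : Finset G) (n : ℕ) {h : G} (hh : h ∈ H) {s : G} (hs : s ∈ slab H t F n) :
    h * s ∈ slab H t F n := by
  obtain ⟨i, h1, h2, h', hh', f, hf, rfl⟩ := hs
  refine ⟨i, h1, h2, t ^ i * h * (t ^ i)⁻¹ * h', mul_mem (ht i h hh) hh', f, hf, ?_⟩
  group

theorem mul_mem_slab_iff {H : Subgroup G} {t : G}
    (ht : ∀ i : ℤ, ∀ h ∈ H, t ^ i * h * (t ^ i)⁻¹ ∈ H) (F : Finset G) (n : ℕ) (h : G) (hh : h ∈ H)
    (s : G) : h * s ∈ slab H t F n ↔ s ∈ slab H t F n :=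
  ⟨fun hs => by simpa using mul_mem_slab ht F n (inv_mem hh) hs, mul_mem_slab ht F n hh⟩

theorem exists_finset_slab_subset {H : Subgroup G} {t : G}
    (ht : ∀ i : ℤ, ∀ h ∈ H, t ^ i * h * (t ^ i)⁻¹ ∈ H) (F : Finset G) (n : ℕ) :
    ∃ F' : Finset G, ∀ x ∈ slab H t F n, ∃ h ∈ H, ∃ f ∈ F', x = h * f := by
  classical
  refine ⟨(Finset.Icc (1 : ℤ) n ×ˢ F).image fun p => t ^ (-p.1) * p.2, ?_⟩
  rintro _ ⟨i, h1, h2, h, hh, f, hf, rfl⟩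
  refine ⟨t ^ (-i) * h * (t ^ (-i))⁻¹, ht _ h hh, t ^ (-i) * f,
    Finset.mem_image.2 ⟨(i, f), by simp [*], rfl⟩, by group⟩

/-- Multiplication by `t` lowers the layer index by one, and layer `1` lands on `H F`. -/
theorem mul_mem_of_mem_slab_succ {H : Subgroup G} {t : G} {F : Finset G} {n : ℕ} {x : G}
    (hx : x ∈ slab H t F (n + 1)) :
    t * x ∈ slab H t F n ∪ {y | ∃ h ∈ H, ∃ f ∈ F, y = h * f} := by
  obtain ⟨i, h1, h2, h, hh, f, hf, rfl⟩ := hx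
  obtain rfl | hi := h1.eq_or_lt
  · exact Or.inr ⟨h, hh, f, hf, by group⟩
  · refine Or.inl ⟨i - 1, by omega, by push_cast at h2; omega, h, hh, f, hf, ?_⟩
    rw [← mul_assoc, ← zpow_one_add]
    congr 2
    ring

theorem exists_leftTranslate_subset_slab {H : Subgroup G} {t : G} {F E : Finset G}
    (hE : ∀ e ∈ E, ∃ i : ℤ, ∃ h ∈ H, ∃ f ∈ F, e = t ^ i * (h * f)) :
    ∃ (j : ℤ) (n : ℕ), ↑(leftTranslate (t ^ j) E) ⊆ slab H t F n := by
  choose! i hi using hE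
  obtain ⟨M, hM⟩ : ∃ M : ℕ, ∀ e ∈ E, (i e).natAbs ≤ M :=
    ⟨E.sup fun e => (i e).natAbs, fun e he => Finset.le_sup (f := fun e => (i e).natAbs) he⟩
  -- Exponents lie in `[-M, M]`; shifting by `-(M + 1)` puts the layer index `M + 1 - k` in `[1, 2M
  -- + 1]`.
  refine ⟨-(M + 1), 2 * M + 1, fun x hx => ?_⟩
  rw [Finset.mem_coe, mem_leftTranslate] at hx
  obtain ⟨h, hh, f, hf, he⟩ := hi _ hx
  have := hM _ hx
  generalize i ((t ^ (-((M : ℤ) + 1)))⁻¹ * x) = k at *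
  refine ⟨M + 1 - k, by omega, by push_cast; omega, h, hh, f, hf, ?_⟩
  rw [inv_mul_eq_iff_eq_mul] at he
  rw [he, ← mul_assoc, ← zpow_add]
  congr 2
  ring

namespace AdmissibleArtinianStructure

variable {𝓗 : AdmissibleArtinianStructure A}

theorem hasDCC_bot (𝓗 : AdmissibleArtinianStructure A) : 𝓗.HasDCC (⊥ : Subgroup G) := by
  intro F Λ hΛ _ hanti
  obtain ⟨N, hN⟩ := IsCylinder.dcc (E := F) (C := fun n => Λ n F) (fun n => (hΛ n).isCylinder F)
    (fun n => (hΛ n).locProj_eq subset_rfl) fun m n h => hanti h F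
  refine ⟨N, fun n hn E hE => ?_⟩
  have hEF : E ⊆ F := fun e he => by
    obtain ⟨h, hh, f, hf, rfl⟩ := hE e he
    rw [Subgroup.mem_bot] at hh
    simpa [hh] using hf
  rw [← (hΛ n).locProj_eq hEF, hN n hn, (hΛ N).locProj_eq hEF]

theorem HasDCC.of_finite {H K : Subgroup G} (hH : 𝓗.HasDCC H) (hHK : H ≤ K) {R : Finset G}
    (hR : ∀ k ∈ K, ∃ h ∈ H, ∃ r ∈ R, k = h * r) : 𝓗.HasDCC K := by
  classical
  intro F Λ hΛ hinv hanti
  obtain ⟨N, hN⟩ := hH (R * F) Λ hΛ (fun n g hg => hinv n g (hHK hg)) hanti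
  refine ⟨N, fun n hn E hE => hN n hn E fun e he => ?_⟩
  obtain ⟨k, hk, f, hf, rfl⟩ := hE e he
  obtain ⟨h, hh, r, hr, rfl⟩ := hR k hk
  exact ⟨h, hh, r * f, Finset.mul_mem_mul hr hf, mul_assoc _ _ _⟩

/-- The Hilbert basis argument. `L m n` collects the "leading coefficients" on `H F` of members of
`Λ m` trivial on `n` layers. It decreases in both indices, so stability of its diagonal under the
condition for `H` gives stability of the whole quadrant `m, n ≥ N`. -/
theorem HasDCC.of_cyclic {H K : Subgroup G} (hH : 𝓗.HasDCC H) (hHK : H ≤ K)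
    (hnorm : ∀ k ∈ K, ∀ h ∈ H, k * h * k⁻¹ ∈ H) {t : G} (ht : t ∈ K)
    (hK : ∀ k ∈ K, ∃ i : ℤ, ∃ h ∈ H, k = t ^ i * h) : 𝓗.HasDCC K := by
  intro F Λ hΛ hinv hanti
  have htn : ∀ i : ℤ, ∀ h ∈ H, t ^ i * h * (t ^ i)⁻¹ ∈ H :=
    fun i => hnorm _ (K.zpow_mem ht i)
  have hinvH : ∀ n, IsShiftInvariant H (Λ n) := fun n g hg => hinv n g (hHK hg)
  set L : ℕ → ℕ → Finset G → Subgroup (G → A) :=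
    fun m n => limProj (relativePart (slab H t F n) (Λ m)) with hL
  have hLanti : ∀ {m m' n n'}, m ≤ m' → n ≤ n' → L m' n' ≤ L m n := fun hm hn E =>
    limProj_mono (relativePart_mono (slab_mono H t F hn) (hanti hm)) E
  obtain ⟨N, hN⟩ := hH F (fun n => L n n)
    (fun n => isSystem_limProj ((hΛ n).isCylinder_relativePart _)
      ((hΛ n).antitone_relativePart _))
    (fun n => ((hinvH n).relativePart (mul_mem_slab_iff htn F n)).limProj)
    fun m n h => hLanti h h
  have hLeq : ∀ m ≥ N, ∀ n ≥ N, ∀ E : Finset G, (∀ e ∈ E, ∃ h ∈ H, ∃ f ∈ F, e = h * f) →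
      L m n E = L N N E := fun m hm n hn E hE => by
    refine le_antisymm (hLanti hm hn E) ?_
    rw [← hN (max m n) (le_max_of_le_left hm) E hE]
    exact hLanti (le_max_left _ _) (le_max_right _ _) E
  -- The first `N` layers lie in `H F'` with `F'` finite, so the condition for `H` applies there.
  -- Thicker slabs follow one layer at a time, with the same bound `N₁`.
  obtain ⟨F', hF'⟩ := exists_finset_slab_subset htn F N
  obtain ⟨N', hN'⟩ := hH F' Λ hΛ hinvH hanti
  set N₁ := max N N'
  have hslab : ∀ m ≥ N₁, ∀ n ≥ N, ∀ E : Finset G, ↑E ⊆ slab H t F n → Λ m E = Λ N₁ E := by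
    intro m hm n hn
    induction n, hn using Nat.le_induction with
    | base =>
      intro E hE
      rw [hN' m ((le_max_right _ _).trans hm) E fun e he => hF' e (hE he),
        hN' N₁ (le_max_right _ _) E fun e he => hF' e (hE he)]
    | succ n hn ih =>
      intro E hE
      have key : Λ m (leftTranslate t E) = Λ N₁ (leftTranslate t E) := by
        refine (hΛ N₁).eq_of_relativePart (hΛ m) (hanti hm) ih
          (S' := {y | ∃ h ∈ H, ∃ f ∈ F, y = h * f})
          (fun E' hE' => ?_) fun x hx => ?_
        · exact (hLeq m ((le_max_left _ _).trans hm) n hn E' hE').trans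
            (hLeq N₁ (le_max_left _ _) n hn E' hE').symm
        · have := mul_mem_of_mem_slab_succ (hE (mem_leftTranslate.1 hx))
          rwa [mul_inv_cancel_left] at this
      rw [hinv m t ht E, hinv N₁ t ht E] at key
      exact Subgroup.comap_injective (coordProj_surjective (mul_right_injective t)) key
  refine ⟨N₁, fun m hm E hE => ?_⟩
  -- Every finite part of `K F` is moved into some slab by a power of `t`, and equality transfers
  -- back by invariance.
  obtain ⟨j, n, hjn⟩ := exists_leftTranslate_subset_slab (H := H) (t := t) (F := F) (E := E)
    fun e he => by
      obtain ⟨k, hk, f, hf, rfl⟩ := hE e he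
      obtain ⟨i, h, hh, rfl⟩ := hK k hk
      exact ⟨i, h, hh, f, hf, mul_assoc _ _ _⟩
  have key := hslab m hm (max n N) (le_max_right _ _) _
    (hjn.trans (slab_mono H t F (le_max_left _ _)))
  have htj : t ^ j ∈ K := K.zpow_mem ht j
  rw [hinv m _ htj E, hinv N₁ _ htj E] at key
  exact Subgroup.comap_injective (coordProj_surjective (mul_right_injective (t ^ j))) key

end AdmissibleArtinianStructure

end DescendingChain

/-! ### Countability and residual finiteness of polycyclic-by-finite groups -/

section PolycyclicByFinite

variable {G : Type*} [Group G]

theorem relIndex_ne_zero_iff_exists_finset {N K : Subgroup G} :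
    N.relIndex K ≠ 0 ↔ ∃ R : Finset G, ∀ k ∈ K, ∃ r ∈ R, r⁻¹ * k ∈ N := by
  classical
  constructor
  · intro h
    have : (N.subgroupOf K).FiniteIndex := ⟨h⟩
    have : Fintype (K ⧸ N.subgroupOf K) := Fintype.ofFinite _
    refine ⟨Finset.univ.image fun q : K ⧸ N.subgroupOf K => (q.out : G), fun k hk => ?_⟩
    refine ⟨_, Finset.mem_image_of_mem _ (Finset.mem_univ (QuotientGroup.mk ⟨k, hk⟩)), ?_⟩
    exact Subgroup.mem_subgroupOf.1 (QuotientGroup.eq.1 (Quotient.out_eq' _))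
  · rintro ⟨R, hR⟩
    choose! r hrR hr using hR
    have : Finite (K ⧸ N.subgroupOf K) := by
      refine Finite.of_injective (β := R)
        (fun q => ⟨r (q.out : G), hrR _ q.out.2⟩) fun p q hpq => ?_
      have hpq' : r (p.out : G) = r (q.out : G) := congrArg Subtype.val hpq
      rw [← QuotientGroup.out_eq' p, ← QuotientGroup.out_eq' q, QuotientGroup.eq,
        Subgroup.mem_subgroupOf]
      have := N.mul_mem (N.inv_mem (hr _ p.out.2)) (hr _ q.out.2)
      rw [hpq'] at this
      simpa [mul_assoc] using this
    exact (Subgroup.finiteIndex_of_finite_quotient (H := N.subgroupOf K)).index_ne_zero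

/-- Induction along a series with cyclic or finite quotients. -/
theorem IsPolycyclicByFinite.induction (hG : IsPolycyclicByFinite G) {P : Subgroup G → Prop}
    (bot : P ⊥)
    (cyclic : ∀ (H K : Subgroup G) (t : G), H ≤ K → (∀ k ∈ K, ∀ h ∈ H, k * h * k⁻¹ ∈ H) → t ∈ K →
      (∀ k ∈ K, ∃ i : ℤ, ∃ h ∈ H, k = t ^ i * h) → P H → P K)
    (finite : ∀ H K : Subgroup G, H ≤ K → H.relIndex K ≠ 0 → P H → P K) :
    P ⊤ := by
  obtain ⟨n, H, h0, hn, hstep⟩ := hG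
  rw [← hn]
  suffices ∀ k ≤ n, P (H k) from this n le_rfl
  intro k
  induction k with
  | zero => exact fun _ => h0 ▸ bot
  | succ k ih =>
    intro hk
    obtain ⟨hle, hnorm, hcyc | hfin⟩ := hstep k hk
    · obtain ⟨q, hq⟩ := hcyc.exists_generator
      obtain ⟨t, rfl⟩ := QuotientGroup.mk_surjective q
      refine cyclic (H k) (H (k + 1)) t hle (fun g hg h hh => ?_) t.2 (fun g hg => ?_)
        (ih (Nat.le_of_succ_le hk))
      · exact hnorm.conj_mem ⟨h, hle hh⟩ hh ⟨g, hg⟩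
      · obtain ⟨i, hi⟩ := hq (QuotientGroup.mk ⟨g, hg⟩)
        refine ⟨i, (t : G) ^ (-i) * g, ?_, by group⟩
        have := QuotientGroup.eq.1 ((QuotientGroup.mk_zpow _ t i).trans hi)
        simpa [Subgroup.mem_subgroupOf] using this
    · refine finite (H k) (H (k + 1)) hle ?_ (ih (Nat.le_of_succ_le hk))
      exact (Subgroup.finiteIndex_of_finite_quotient
        (H := (H k).subgroupOf (H (k + 1)))).index_ne_zero

theorem IsPolycyclicByFinite.countable (hG : IsPolycyclicByFinite G) : Countable G := by
  have : ((⊤ : Subgroup G) : Set G).Countable := by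
    refine hG.induction (P := fun H => (H : Set G).Countable) (by simp) ?_ ?_
    · intro H K t _ _ _ hK hH
      refine (Set.Countable.image2 (Set.countable_range fun i : ℤ => t ^ i) hH (· * ·)).mono ?_
      intro k hk
      obtain ⟨i, h, hh, rfl⟩ := hK k hk
      exact ⟨_, ⟨i, rfl⟩, h, hh, rfl⟩
    · intro H K _ hHK hH
      obtain ⟨R, hR⟩ := relIndex_ne_zero_iff_exists_finset.1 hHK
      refine (Set.Countable.image2 R.countable_toSet hH (· * ·)).mono ?_
      intro k hk
      obtain ⟨r, hr, hrk⟩ := hR k hk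
      exact ⟨r, hr, _, hrk, mul_inv_cancel_left _ _⟩
  exact Set.countable_univ_iff.1 (by simpa using this)

/-- The subgroup generated by the `m`-th powers of elements of `H`. -/
def powSubgroup (m : ℕ) (H : Subgroup G) : Subgroup G :=
  Subgroup.closure {x | ∃ h ∈ H, h ^ m = x}

theorem pow_mem_powSubgroup {m : ℕ} {H : Subgroup G} {h : G} (hh : h ∈ H) :
    h ^ m ∈ powSubgroup m H := Subgroup.subset_closure ⟨h, hh, rfl⟩

theorem powSubgroup_mono (m : ℕ) {H K : Subgroup G} (h : H ≤ K) :
    powSubgroup m H ≤ powSubgroup m K :=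
  Subgroup.closure_mono fun _ ⟨g, hg, hx⟩ => ⟨g, h hg, hx⟩

theorem powSubgroup_le {m : ℕ} {H N : Subgroup G} (h : ∀ g ∈ H, g ^ m ∈ N) :
    powSubgroup m H ≤ N :=
  (Subgroup.closure_le _).2 fun _ ⟨g, hg, hx⟩ => hx ▸ h g hg

theorem conj_mem_powSubgroup {m : ℕ} {H : Subgroup G} {k : G} (hk : ∀ h ∈ H, k * h * k⁻¹ ∈ H)
    {x : G} (hx : x ∈ powSubgroup m H) : k * x * k⁻¹ ∈ powSubgroup m H := by
  have : powSubgroup m H ≤ (powSubgroup m H).comap (MulAut.conj k).toMonoidHom := by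
    refine powSubgroup_le fun g hg => ?_
    simp only [Subgroup.mem_comap, MulEquiv.toMonoidHom_eq_coe, MonoidHom.coe_coe, map_pow,
      MulAut.conj_apply]
    exact pow_mem_powSubgroup (hk g hg)
  simpa using this hx

/-- If `P` has finite index in `H` and is normalised by `t`, then `P` and a positive power of `t`
span a subgroup of finite index in `⟨t⟩ H`. -/
theorem relIndex_sup_zpowers_ne_zero {P H K : Subgroup G} {t : G}
    (hK : ∀ k ∈ K, ∃ i : ℤ, ∃ h ∈ H, k = t ^ i * h) (hPH : P.relIndex H ≠ 0)
    (hH : ∀ i : ℤ, ∀ h ∈ H, t ^ i * h * (t ^ i)⁻¹ ∈ H)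
    (hP : ∀ i : ℤ, ∀ p ∈ P, t ^ i * p * (t ^ i)⁻¹ ∈ P) {n : ℕ} (hn : 0 < n) :
    (P ⊔ Subgroup.zpowers (t ^ n)).relIndex K ≠ 0 := by
  classical
  obtain ⟨R, hR⟩ := relIndex_ne_zero_iff_exists_finset.1 hPH
  refine relIndex_ne_zero_iff_exists_finset.2
    ⟨R * (Finset.Ico (0 : ℤ) n).image (t ^ ·), fun k hk => ?_⟩
  obtain ⟨i, h, hh, rfl⟩ := hK k hk
  obtain ⟨r, hr, hrp⟩ := hR _ (hH i h hh)
  have hn' : (0 : ℤ) < n := by exact_mod_cast hn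
  refine ⟨r * t ^ (i % n), Finset.mul_mem_mul hr (Finset.mem_image_of_mem _ (Finset.mem_Ico.2
    ⟨Int.emod_nonneg _ hn'.ne', Int.emod_lt_of_pos _ hn'⟩)), ?_⟩
  have hmem := mul_mem (Subgroup.mem_sup_left (T := Subgroup.zpowers (t ^ n))
    (hP (-(i % n)) _ hrp)) (Subgroup.mem_sup_right (S := P)
      (Subgroup.zpow_mem_zpowers (t ^ n) (i / n)))
  convert hmem using 1
  have hi : t ^ i = t ^ (i % n) * (t ^ n) ^ (i / n) := by
    rw [← zpow_natCast, ← zpow_mul, ← zpow_add, Int.emod_add_mul_ediv]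
  rw [mul_inv_rev, mul_assoc, mul_assoc _ _ ((t ^ n) ^ (i / n)), zpow_neg, inv_inv, ← hi]
  group

theorem exists_of_mem_sup_zpowers {P : Subgroup G} {s : G}
    (hP : ∀ i : ℤ, ∀ p ∈ P, s ^ i * p * (s ^ i)⁻¹ ∈ P) {x : G} (hx : x ∈ P ⊔ Subgroup.zpowers s) :
    ∃ p ∈ P, ∃ j : ℤ, x = p * s ^ j := by
  let B : Subgroup G :=
    { carrier := {x | ∃ p ∈ P, ∃ j : ℤ, x = p * s ^ j}
      one_mem' := ⟨1, P.one_mem, 0, by simp⟩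
      mul_mem' := by
        rintro _ _ ⟨p, hp, i, rfl⟩ ⟨q, hq, j, rfl⟩
        exact ⟨p * (s ^ i * q * (s ^ i)⁻¹), P.mul_mem hp (hP i q hq), i + j, by group⟩
      inv_mem' := by
        rintro _ ⟨p, hp, i, rfl⟩
        exact ⟨s ^ (-i) * p⁻¹ * (s ^ (-i))⁻¹, hP _ _ (P.inv_mem hp), -i, by group⟩ }
  refine (sup_le (c := B) (fun p hp => ⟨p, hp, 0, by simp⟩) ?_) hx
  rw [Subgroup.zpowers_le]
  exact ⟨1, P.one_mem, 1, by simp⟩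

/-- `H` is residually finite, and its power subgroups have finite index. -/
structure IsResiduallyFiniteWithPowers (H : Subgroup G) : Prop where
  pow_relIndex : ∀ m : ℕ, 0 < m → (powSubgroup m H).relIndex H ≠ 0
  exists_notMem : ∀ x ∈ H, x ≠ 1 → ∃ N : Subgroup G, N.relIndex H ≠ 0 ∧ x ∉ N

theorem relIndex_ne_zero_of_le_left {P N K : Subgroup G} (h : P ≤ N) (hP : P.relIndex K ≠ 0) :
    N.relIndex K ≠ 0 := fun h0 => hP (Subgroup.relIndex_eq_zero_of_le_left h h0)

theorem IsResiduallyFiniteWithPowers.of_finite {H K : Subgroup G}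
    (hH : IsResiduallyFiniteWithPowers H) (hHK : H ≤ K) (hfin : H.relIndex K ≠ 0) :
    IsResiduallyFiniteWithPowers K := by
  refine ⟨fun m hm => relIndex_ne_zero_of_le_left (powSubgroup_mono m hHK)
    (Subgroup.relIndex_ne_zero_trans (hH.1 m hm) hfin), fun x _ hx1 => ?_⟩
  by_cases hxH : x ∈ H
  · obtain ⟨N, hN, hxN⟩ := hH.2 x hxH hx1
    exact ⟨N, Subgroup.relIndex_ne_zero_trans hN hfin, hxN⟩
  · exact ⟨H, hfin, hxH⟩

/-- A finite-index `N` in `H` need not be normalised by `t`, but the power subgroups of `H` are.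
Joined with a power of `t`, they give finite-index subgroups of `K`. -/
theorem IsResiduallyFiniteWithPowers.of_cyclic {H K : Subgroup G} {t : G}
    (hH : IsResiduallyFiniteWithPowers H) (hHK : H ≤ K)
    (hnorm : ∀ k ∈ K, ∀ h ∈ H, k * h * k⁻¹ ∈ H) (ht : t ∈ K)
    (hK : ∀ k ∈ K, ∃ i : ℤ, ∃ h ∈ H, k = t ^ i * h) : IsResiduallyFiniteWithPowers K := by
  have htH : ∀ i : ℤ, ∀ h ∈ H, t ^ i * h * (t ^ i)⁻¹ ∈ H := fun i => hnorm _ (K.zpow_mem ht i)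
  have htP : ∀ m, ∀ i : ℤ, ∀ p ∈ powSubgroup m H, t ^ i * p * (t ^ i)⁻¹ ∈ powSubgroup m H :=
    fun m i p => conj_mem_powSubgroup (htH i)
  -- If a positive power of `t` lies in `H`, the extension is finite; otherwise `⟨t⟩` meets `H`
  -- trivially.
  by_cases htn : ∃ n : ℕ, 0 < n ∧ t ^ n ∈ H
  · obtain ⟨n, hn, htn⟩ := htn
    refine hH.of_finite hHK (relIndex_ne_zero_of_le_left (sup_le le_rfl ?_)
      (relIndex_sup_zpowers_ne_zero (P := H) hK (by simp) htH htH hn))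
    rwa [Subgroup.zpowers_le]
  have hzpow : ∀ i : ℤ, t ^ i ∈ H → i = 0 := by
    intro i hi
    by_contra h0
    refine htn ⟨i.natAbs, Int.natAbs_pos.2 h0, ?_⟩
    obtain h | h := Int.natAbs_eq i <;> rw [h] at hi
    · exact_mod_cast hi
    · rw [zpow_neg, inv_mem_iff] at hi
      exact_mod_cast hi
  refine ⟨fun m hm => ?_, fun x hxK hx1 => ?_⟩
  · refine relIndex_ne_zero_of_le_left (sup_le (powSubgroup_mono m hHK) ?_)
      (relIndex_sup_zpowers_ne_zero hK (hH.1 m hm) htH (htP m) hm)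
    rw [Subgroup.zpowers_le]
    exact pow_mem_powSubgroup ht
  obtain ⟨i, h, hh, rfl⟩ := hK x hxK
  obtain rfl | hi := eq_or_ne i 0
  · simp only [zpow_zero, one_mul] at hx1 ⊢
    obtain ⟨N, hN, hhN⟩ := hH.2 h hh hx1
    -- Each `g ∈ H` has a power `g ^ l ∈ N` with `0 < l ≤ [H : N]`, and `l` divides this factorial.
    set m := (N.relIndex H).factorial
    have hPN : powSubgroup m H ≤ N := powSubgroup_le fun g hg =>
      (Subgroup.pow_mem_of_relIndex_ne_zero_of_dvd hN hg fun l hl hlm =>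
        Nat.dvd_factorial hl hlm).1
    refine ⟨_, relIndex_sup_zpowers_ne_zero hK (hH.1 m (Nat.factorial_pos _)) htH (htP m)
      one_pos, fun hmem => hhN ?_⟩
    rw [pow_one] at hmem
    obtain ⟨p, hp, j, rfl⟩ := exists_of_mem_sup_zpowers (htP m) hmem
    have hpH : p ∈ H := powSubgroup_le (fun g hg => H.pow_mem hg m) hp
    rw [hzpow j ((H.mul_mem_cancel_left hpH).1 hh)]
    simpa using hPN hp
  -- Joining `H` with `t ^ (|i| + 1)` excludes the element, since `|i| + 1` cannot divide `i ≠ 0`.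
  · refine ⟨_, relIndex_sup_zpowers_ne_zero (P := H) hK (by simp) htH htH
      (Nat.succ_pos i.natAbs), fun hmem => hi ?_⟩
    obtain ⟨p, hp, j, hj⟩ := exists_of_mem_sup_zpowers (P := H) (fun j p hp => by
      rw [← zpow_natCast, ← zpow_mul]
      exact htH _ p hp) hmem
    have hdiff : i - (i.natAbs.succ : ℤ) * j = 0 := by
      refine hzpow _ ?_
      rw [← zpow_natCast, ← zpow_mul] at hj
      have h2 : t ^ (i - (i.natAbs.succ : ℤ) * j) = p * (t ^ ((i.natAbs.succ : ℤ) * j) * h⁻¹ *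
          (t ^ ((i.natAbs.succ : ℤ) * j))⁻¹) := by
        rw [zpow_sub, eq_mul_inv_of_mul_eq hj]
        group
      rw [h2]
      exact H.mul_mem hp (htH _ _ (H.inv_mem hh))
    have hdvd : ((i.natAbs.succ : ℕ) : ℤ) ∣ i := ⟨j, by omega⟩
    have := Int.natAbs_dvd_natAbs.2 hdvd
    rw [Int.natAbs_natCast] at this
    by_contra h0
    have := Nat.le_of_dvd (Int.natAbs_pos.2 h0) this
    omega

theorem IsPolycyclicByFinite.exists_finiteIndex_notMem (hG : IsPolycyclicByFinite G)
    (D : Finset G) (hD : ∀ d ∈ D, d ≠ 1) :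
    ∃ N : Subgroup G, N.FiniteIndex ∧ ∀ d ∈ D, d ∉ N := by
  have hres : IsResiduallyFiniteWithPowers (⊤ : Subgroup G) := by
    refine hG.induction (P := IsResiduallyFiniteWithPowers) ⟨fun m _ => by simp, ?_⟩
      (fun H K t hHK hnorm ht hK hH => hH.of_cyclic hHK hnorm ht hK)
      fun H K hHK hfin hH => hH.of_finite hHK hfin
    exact fun x hx hx1 => (hx1 (Subgroup.mem_bot.1 hx)).elim
  have h : ∀ d : D, ∃ N : Subgroup G, N.index ≠ 0 ∧ d.1 ∉ N := fun d => by
    simpa using hres.exists_notMem d.1 trivial (hD d.1 d.2)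
  choose N hN hdN using h
  exact ⟨⨅ d, N d, ⟨Subgroup.index_iInf_ne_zero hN⟩,
    fun d hd hmem => hdN ⟨d, hd⟩ (Subgroup.mem_iInf.1 hmem ⟨d, hd⟩)⟩

end PolycyclicByFinite

/-! ### Finite type and periodic approximation -/

section PeriodicDensity

variable {G A : Type*} [Group A] [Group G] {𝓗 : AdmissibleArtinianStructure A}

theorem IsPolycyclicByFinite.hasDCC (hG : IsPolycyclicByFinite G)
    (𝓗 : AdmissibleArtinianStructure A) : 𝓗.HasDCC (⊤ : Subgroup G) := by
  classical
  refine hG.induction (P := 𝓗.HasDCC) 𝓗.hasDCC_bot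
    (fun H K t hHK hnorm ht hK hH => hH.of_cyclic hHK hnorm ht hK) fun H K hHK hfin hH => ?_
  obtain ⟨R, hR⟩ := relIndex_ne_zero_iff_exists_finset.1 hfin
  refine hH.of_finite hHK (R := R⁻¹) fun k hk => ?_
  obtain ⟨r, hr, hrk⟩ := hR k⁻¹ (K.inv_mem hk)
  refine ⟨_, H.inv_mem hrk, r⁻¹, Finset.inv_mem_inv hr, by group⟩

/-- Under the descending chain condition, every system is determined by a single window. -/
theorem AdmissibleArtinianStructure.IsSystem.exists_window [Countable G]
    (hdcc : 𝓗.HasDCC (⊤ : Subgroup G)) {S : Finset G → Subgroup (G → A)} (hS : 𝓗.IsSystem S) :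
    ∃ M : Finset G, ∀ x : G → A, (∀ g, shiftHom A g x ∈ S M) → ∀ E, x ∈ S E := by
  -- `C M T` imposes the window `M` at the positions in `T`; `limProj (C M)` stands for the subshift
  -- of finite type with window `M`.
  set C : Finset G → Finset G → Subgroup (G → A) :=
    fun M T => ⨅ g ∈ T, (S M).comap (shiftHom A g) with hC
  have memC : ∀ {M T x}, x ∈ C M T ↔ ∀ g ∈ T, shiftHom A g x ∈ S M := by
    simp [hC, Subgroup.mem_iInf]
  have hcyl : ∀ M T, 𝓗.IsCylinder (C M T) := fun M T => by
    rw [hC]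
    simp_rw [← Finset.inf_eq_iInf]
    exact isCylinder_finset_inf T fun g => (hS.isCylinder M).comap_shiftHom g
  have hanti : ∀ M, Antitone (C M) := fun M T T' h x hx =>
    memC.2 fun g hg => memC.1 hx g (h hg)
  have hinv : ∀ M, IsShiftInvariant ⊤ (C M) := fun M k _ T => by
    ext x
    rw [Subgroup.mem_comap, memC, memC]
    have key : ∀ g, shiftHom A g (shiftHom A k x) = shiftHom A (k * g) x := fun g =>
      funext fun h => by simp only [shiftHom_apply, mul_assoc]
    simp_rw [key]
    refine ⟨fun h g hg => h _ (mul_mem_leftTranslate.2 hg), fun h g hg => ?_⟩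
    simpa using h _ (mem_leftTranslate.1 hg)
  have hmono : ∀ {M M'}, M ⊆ M' → ∀ T, C M' T ≤ C M T := fun h T x hx =>
    memC.2 fun g hg => hS.antitone h (memC.1 hx g hg)
  obtain ⟨M, hM, hMtop⟩ := Filter.exists_seq_monotone_tendsto_atTop_atTop (Finset G)
  -- For `H = ⊤` and `F = {1}` the set `H F` is all of `G`, so equality holds on every finite set.
  obtain ⟨N, hN⟩ := hdcc {1} (fun n => limProj (C (M n)))
    (fun n => AdmissibleArtinianStructure.isSystem_limProj (hcyl _) (hanti _))
    (fun n => (hinv _).limProj) fun m n h E => limProj_mono (hmono (hM h)) E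
  refine ⟨M N, fun x hx E => ?_⟩
  obtain ⟨n, hnE, hnN⟩ := ((Filter.tendsto_atTop.1 hMtop E).and
    (Filter.eventually_ge_atTop N)).exists
  have hxE : x ∈ limProj (C (M N)) E :=
    Subgroup.mem_iInf.2 fun T => le_locProj _ _ (memC.2 fun g _ => hx g)
  rw [← hN n hnN E fun e _ => ⟨e, trivial, 1, by simp, by simp⟩] at hxE
  rw [← hS.locProj_eq hnE]
  refine locProj_mono E (fun y hy => ?_) (limProj_le _ E {1} hxE)
  have := memC.1 hy 1 (Finset.mem_singleton_self 1)
  convert this using 1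
  funext h
  simp [shiftHom_apply]

/-- The restrictions of an admissible group subshift to finite sets form a system. -/
theorem IsAdmissibleGroupSubshift.exists_isSystem [TopologicalSpace A] [DiscreteTopology A]
    {X : SymbolicDynamics.FullShift.MulSubshift A G} (hX : IsAdmissibleGroupSubshift 𝓗 X) :
    ∃ S : Finset G → Subgroup (G → A), 𝓗.IsSystem S ∧
      ∀ E x, x ∈ S E ↔ ∃ y ∈ X.carrier, ∀ g ∈ E, y g = x g := by
  have hne : ∃ y, y ∈ X.carrier := by
    -- Nonemptiness comes from a one-point window, whose restriction is a subgroup; it is needed for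
    -- the empty window.
    obtain ⟨e, H, -, hH⟩ := hX {1} (Finset.singleton_nonempty 1)
    obtain ⟨y, hy, -⟩ := hH.ge (one_mem _)
    exact ⟨y, hy⟩
  have key : ∀ E : Finset G, ∃ C : Subgroup (G → A), 𝓗.IsCylinder C ∧
      ∀ x, x ∈ C ↔ ∃ y ∈ X.carrier, ∀ g ∈ E, y g = x g := by
    intro E
    obtain rfl | hE := E.eq_empty_or_nonempty
    · exact ⟨⊤, 𝓗.isCylinder_top, fun x => by simpa using hne⟩
    · obtain ⟨e, H, hH, hXH⟩ := hX E hE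
      refine ⟨H.comap (coordProj A fun i => (e i : G)), ⟨_, ?_, _,
        Subtype.val_injective.comp e.injective, H, hH, rfl⟩, fun x => ?_⟩
      · simpa using hE.card_pos
      · have := Set.ext_iff.1 hXH fun i : E => x i
        refine Iff.trans this.symm ⟨?_, ?_⟩
        · rintro ⟨y, hy, hyx⟩
          exact ⟨y, hy, fun g hg => congrFun hyx ⟨g, hg⟩⟩
        · rintro ⟨y, hy, hyx⟩
          exact ⟨y, hy, funext fun i => hyx i i.2⟩
  choose S hS hSX using key
  refine ⟨S, ⟨hS, fun {E' E} h => ?_⟩, hSX⟩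
  ext x
  rw [hSX, mem_locProj]
  constructor
  · rintro ⟨y, hy, hyx⟩
    obtain ⟨z, hz, hzy⟩ := (hSX E y).1 hy
    exact ⟨z, hz, fun g hg => (hzy g (h hg)).trans (hyx g hg)⟩
  · rintro ⟨y, hy, hyx⟩
    exact ⟨y, (hSX E y).2 ⟨y, hy, fun _ _ => rfl⟩, hyx⟩

omit [Group A] [Group G] in
theorem mem_closure_of_forall_finset [TopologicalSpace A]
    {s : Set (G → A)} {x : G → A} (h : ∀ E : Finset G, ∃ y ∈ s, ∀ g ∈ E, y g = x g) :
    x ∈ closure s := by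
  refine mem_closure_iff.2 fun o ho hxo => ?_
  obtain ⟨E, u, hu, hsub⟩ := isOpen_pi_iff.1 ho x hxo
  obtain ⟨y, hy, hyx⟩ := h E
  exact ⟨y, hsub fun g hg => by rw [hyx g hg]; exact (hu g hg).2, hy⟩

/-- If the pattern `w` on `B` is trivial off `B₀`, and the translates of `B` by elements of `N` are
disjoint, then the translates of `w` can be assembled to an `N`-invariant configuration. -/
theorem exists_invariant_configuration {N : Subgroup G} {B₀ B : Finset G} (hB : B₀ ⊆ B)
    (hN : ∀ b ∈ B, ∀ b' ∈ B, b' * b⁻¹ ∈ N → b' = b) {w : G → A}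
    (hw : ∀ b ∈ B, b ∉ B₀ → w b = 1) :
    ∃ y : G → A, (∀ k ∈ N, ∀ b ∈ B, y (k * b) = w b) ∧ (∀ k ∈ N, ∀ h, y (k * h) = y h) ∧
      ∀ h, (∀ k ∈ N, k⁻¹ * h ∉ B₀) → y h = 1 := by
  classical
  set y : G → A := fun h =>
    if H : ∃ k, k ∈ N ∧ k⁻¹ * h ∈ B₀ then w (H.choose⁻¹ * h) else 1 with hy
  have h1 : ∀ k ∈ N, ∀ b ∈ B, y (k * b) = w b := by
    intro k hk b hb
    by_cases H : ∃ k', k' ∈ N ∧ k'⁻¹ * (k * b) ∈ B₀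
    · simp only [hy, dif_pos H]
      rw [hN b hb _ (hB H.choose_spec.2)]
      rw [mul_assoc, mul_inv_cancel_right]
      exact N.mul_mem (N.inv_mem H.choose_spec.1) hk
    · simp only [hy, dif_neg H]
      exact (hw b hb fun hb₀ => H ⟨k, hk, by simpa using hb₀⟩).symm
  have h3 : ∀ h, (∀ k ∈ N, k⁻¹ * h ∉ B₀) → y h = 1 := fun h H => by
    simp only [hy]
    rw [dif_neg]
    rintro ⟨k, hk, hkh⟩
    exact H k hk hkh
  refine ⟨y, h1, fun k hk h => ?_, h3⟩
  by_cases H : ∃ k', k' ∈ N ∧ k'⁻¹ * h ∈ B₀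
  · obtain ⟨k', hk', hb⟩ := H
    have e1 := h1 k' hk' _ (hB hb)
    have e2 := h1 (k * k') (N.mul_mem hk hk') _ (hB hb)
    rw [mul_inv_cancel_left] at e1
    rw [mul_assoc, mul_inv_cancel_left] at e2
    rw [e1, e2]
  · push Not at H
    rw [h3 h H, h3 _ fun k' hk' => ?_]
    have := H (k⁻¹ * k') (N.mul_mem (N.inv_mem hk) hk')
    rwa [mul_inv_rev, inv_inv, mul_assoc] at this

omit [Group A] in
-- The translate of `y` by `g` depends only on the coset `gN`.
theorem isPeriodicConfig_of_finiteIndex {N : Subgroup G} [N.FiniteIndex] {y : G → A}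
    (hy : ∀ k ∈ N, ∀ h, y (k * h) = y h) : IsPeriodicConfig y := by
  refine (Set.finite_range fun q : G ⧸ N => fun h => y (q.out⁻¹ * h)).subset ?_
  rintro _ ⟨g, rfl⟩
  refine ⟨QuotientGroup.mk g, funext fun h => ?_⟩
  have hk : (QuotientGroup.mk g : G ⧸ N).out⁻¹ * g ∈ N :=
    QuotientGroup.eq.1 (QuotientGroup.out_eq' _)
  have := hy _ hk (g⁻¹ * h)
  rwa [mul_assoc, mul_inv_cancel_left] at this

end PeriodicDensity

theorem mainTheorem12 {G : Type*} [Group G] (hG : IsPolycyclicByFinite G)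
    {A : Type*} [Group A] [TopologicalSpace A] [DiscreteTopology A]
    (𝓗 : AdmissibleArtinianStructure A)
    (X : SymbolicDynamics.FullShift.MulSubshift A G)
    (hX : IsAdmissibleGroupSubshift 𝓗 X)
    (hirr : IsStronglyIrreducible X.carrier) :
    X.carrier ⊆ closure {x | x ∈ X.carrier ∧ IsPeriodicConfig x} := by
  classical
  have := hG.countable
  obtain ⟨S, hS, hSX⟩ := hX.exists_isSystem
  obtain ⟨M, hM⟩ := hS.exists_window (hG.hasDCC 𝓗)
  have hmem : ∀ x, (∀ g, shiftHom A g x ∈ S M) → x ∈ X.carrier := fun x hx => by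
    rw [← X.isClosed.closure_eq]
    exact mem_closure_of_forall_finset fun E => (hSX E x).1 (hM x hx E)
  have hone : (1 : G → A) ∈ X.carrier := hmem 1 fun _ => (S M).one_mem
  obtain ⟨Δ, hΔ⟩ := hirr
  intro x hx
  refine mem_closure_of_forall_finset fun Ω => ?_
  -- `B \ B₀` avoids `Ω Δ`, so the pattern of `x` on `Ω` can be glued to `1` there. A window `g M`
  -- meeting `B₀` lies inside `B₀ M⁻¹ M`, hence in `B`.
  set B₀ := Ω ∪ Ω * Δ
  set B := B₀ ∪ B₀ * M⁻¹ * M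
  obtain ⟨w, hwX, hw1, hwx⟩ := hΔ (B \ B₀) Ω (by
    rw [← Finset.coe_mul, Finset.disjoint_coe]
    exact Finset.disjoint_of_subset_right Finset.subset_union_right Finset.sdiff_disjoint)
    1 hone x hx
  -- Avoiding the nontrivial elements of `B B⁻¹` makes the translates `k B`, `k ∈ N`, pairwise
  -- disjoint.
  obtain ⟨N, hNfin, hN⟩ := hG.exists_finiteIndex_notMem ((B * B⁻¹).erase 1)
    fun d hd => Finset.ne_of_mem_erase hd
  obtain ⟨y, hy1, hy2, hy3⟩ := exists_invariant_configuration (N := N) (B₀ := B₀) (B := B)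
    (w := w) Finset.subset_union_left (fun b hb b' hb' hbb => by
      by_contra hne
      exact hN _ (Finset.mem_erase.2 ⟨fun h => hne (mul_inv_eq_one.1 h),
        Finset.mul_mem_mul hb' (Finset.inv_mem_inv hb)⟩) hbb)
    fun b hb hb₀ => hw1 b (Finset.mem_sdiff.2 ⟨hb, hb₀⟩)
  refine ⟨y, ⟨hmem y fun g => ?_, isPeriodicConfig_of_finiteIndex hy2⟩, fun g hg => ?_⟩
  · rw [hSX]
    -- Either `g M` meets some `k B₀`, so it lies in `k B` where `y` is a translate of `w`, or `y`
    -- is trivial on `g M`.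
    by_cases H : ∃ m ∈ M, ∃ k ∈ N, k⁻¹ * (g * m) ∈ B₀
    · obtain ⟨m, hm, k, hk, hkm⟩ := H
      refine ⟨_, X.mapsTo (k⁻¹ * g) hwX, fun m' hm' => ?_⟩
      have hb : k⁻¹ * g * m' ∈ B := by
        have := Finset.mul_mem_mul (Finset.mul_mem_mul hkm (Finset.inv_mem_inv hm)) hm'
        refine Finset.mem_union_right _ ?_
        convert this using 1
        group
      have := hy1 k hk _ hb
      rw [SymbolicDynamics.FullShift.mulShift_apply, ← this, shiftHom_apply]
      congr 1
      group
    · push Not at H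
      exact ⟨1, hone, fun m hm => (hy3 _ (H m hm)).symm⟩
  · rw [← hwx g hg, ← hy1 1 N.one_mem g (Finset.mem_union_left _ (Finset.mem_union_left _ hg)),
      one_mul]
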